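/- Let $\mathbb K\in\{\mathbb R,\mathbb C\}$, let $w$ be the space of all sequences $x=(x_n)_{n\ge 0}$ in $\mathbb K$, let $p=(p_k)_{k\ge0}$ be a bounded sequence of strictly positive real numbers, and let $r,s,t\in w$ with $r_n\ne0$ and $t_n\ne 0$ for all $n$ and $s_0\neq 0$. Put \[ l_\infty(p)=\{x\in w:\sup_k|x_k|^{p_k}<\infty\},\qquad c(p)=\{x\in w:\exists\, l\in\mathbb K,\ \lim_k|x_k-l|^{p_k}=0\}, \] \[ c_0(p)=\{x\in w:\lim_k|x_k|^{p_k}=0\},\qquad l(p)=\Big\{x\in w:\sum_{k}|x_k|^{p_k}<\infty\Big\}. \] With $\Delta x_k=x_k-x_{k-1}$, $x_{-1}=0$, let \[ X(r,s,t,p;\Delta)=\Big\{x\in w:\Big(\tfrac1{r_n}\sum_{k=0}^n s_{n-k}t_k\,\Delta x_k\Big)_{n}\in X\Big\},\qquad X\in\{l_\infty(p),c(p),c_0(p),l(p)\}, \] and denote these spaces by $l_\infty(r,s,t,p;\Delta)$, $c(r,s,t,p;\Delta)$, $c_0(r,s,t,p;\Delta)$ and $l(r,s,t,p;\Delta)$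 respectively. The $\gamma$-dual of $U\subseteq w$ is \[ U^\gamma=\Big\{a\in w:\ \sup_n\Big|\sum_{k=0}^n a_ku_k\Big|<\infty\ \text{ for all } u\in U\Big\}. \] Let $D^{(s)}_0=1/s_0$ and, for $n\ge1$, $D_n^{(s)}=s_0^{-(n+1)}\det(d_{ij})_{1\le i,j\le n}$, where $d_{ij}=s_{i-j+1}$ for $j\le i+1$ and $d_{ij}=0$ for $j>i+1$. For $a\in w$ let $E=(e_{nk})_{n,k\ge 0}$ be the matrix with $e_{nk}=0$ for $k>n$ and \[ e_{nk}=r_k\Big[\frac{a_k}{s_0t_k}+\Big(\frac{D_0^{(s)}}{t_k}-\frac{D_1^{(s)}}{t_{k+1}}\Big)\sum_{j=k+1}^n a_j+\sum_{l=k+2}^n(-1)^{l-k}\frac{D_{l-k}^{(s)}}{t_l}\sum_{j=l}^n a_j\Big]\qquad(0\le k\le n), \] empty sums being $0$. With $\mathbb N=\{1,2,\dots\}$, and with $p_k'=p_k/(p_k-1)$ in the definition of $\Gamma_5(p)$, which is used only when all $p_k>1$, put \[ \Gamma_1(p)=\bigcup_{L\in\mathbb N}\Big\{a\in w:\sup_n\sum_{k}|e_{nk}|L^{-1/p_k}<\infty\Big\},\qquad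 \Gamma_2(p)=\Big\{a\in w:\sup_n\Big|\sum_k e_{nk}\Big|<\infty\Big\}, \] \[ \Gamma_3(p)=\bigcap_{L\in\mathbb N}\Big\{a\in w:\sup_n\sum_{k}|e_{nk}|L^{1/p_k}<\infty\Big\},\qquad \Gamma_4(p)=\bigcup_{L\in\mathbb N}\Big\{a\in w:\sup_n\sup_k|e_{nk}L^{-1}|^{p_k}<\infty\Big\}, \] \[ \Gamma_5(p)=\bigcup_{L\in\mathbb N}\Big\{a\in w:\sup_n\sum_k|e_{nk}L^{-1}|^{p_k'}<\infty\Big\}. \] Then: (a) if $p_k>1$ for all $k$, then $[l(r,s,t,p;\Delta)]^\gamma=\Gamma_5(p)$; if $0<p_k\le1$ for all $k$, then $[l(r,s,t,p;\Delta)]^\gamma=\Gamma_4(p)$; (b) in general (that is, $0<p_k\le \sup_j p_j<\infty$ for all $k$), $[c_0(r,s,t,p;\Delta)]^\gamma=\Gamma_1(p)$, $[c(r,s,t,p;\Delta)]^\gamma=\Gamma_1(p)\cap\Gamma_2(p)$ and $[l_\infty(r,s,t,p;\Delta)]^\gamma=\Gamma_3(p)$. -/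

import Mathlib

namespace GenMeans

noncomputable section

open Filter Topology

variable {𝕜 : Type*} [RCLike 𝕜]

/-- Maddox's space `l_∞(p)`. -/
def maddoxLinf (p : ℕ → ℝ) : Set (ℕ → 𝕜) :=
  {x | BddAbove (Set.range fun k => ‖x k‖ ^ p k)}

/-- Maddox's space `c(p)`. -/
def maddoxC (p : ℕ → ℝ) : Set (ℕ → 𝕜) :=
  {x | ∃ l : 𝕜, Tendsto (fun k => ‖x k - l‖ ^ p k) atTop (𝓝 0)}

/-- Maddox's space `c_0(p)`. -/
def maddoxC0 (p : ℕ → ℝ) : Set (ℕ → 𝕜) :=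
  {x | Tendsto (fun k => ‖x k‖ ^ p k) atTop (𝓝 0)}

/-- Maddox's space `l(p)`. -/
def maddoxL (p : ℕ → ℝ) : Set (ℕ → 𝕜) :=
  {x | Summable fun k => ‖x k‖ ^ p k}

/-- The space `bs` of sequences whose series has bounded partial sums. -/
def bs : Set (ℕ → 𝕜) :=
  {x | BddAbove (Set.range fun n => ‖∑ k ∈ Finset.range (n + 1), x k‖)}

/-- The multiplier space `M(U, V)`. -/
def multiplierSpace (U V : Set (ℕ → 𝕜)) : Set (ℕ → 𝕜) :=
  {a | ∀ u ∈ U, (fun n => a n * u n) ∈ V}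

/-- The `γ`-dual `M(U, bs)` of `U`. -/
def gammaDual (U : Set (ℕ → 𝕜)) : Set (ℕ → 𝕜) :=
  multiplierSpace U bs

/-- The difference operator `Δ x_k = x_k - x_{k-1}`, with `x_{-1} = 0`. -/
def diff (x : ℕ → 𝕜) : ℕ → 𝕜
  | 0 => x 0
  | k + 1 => x (k + 1) - x k

/-- The sequence of generalized means `(1 / r_n) ∑_{k ≤ n} s_{n-k} t_k x_k` of `x`. -/
def genMean (r s t x : ℕ → 𝕜) (n : ℕ) : 𝕜 :=
  (1 / r n) * ∑ k ∈ Finset.range (n + 1), s (n - k) * t k * x k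

/-- The space `X(r, s, t; Δ)` of all `x` for which the generalized means of `Δ x` lie in `X`. -/
def meanDiffSpace (X : Set (ℕ → 𝕜)) (r s t : ℕ → 𝕜) : Set (ℕ → 𝕜) :=
  {x | genMean r s t (diff x) ∈ X}

/-- The number `D_n^{(s)}`: `s_0^{-(n+1)}` times the `n × n` determinant with entry `s_{i-j+1}` in
row `i` and column `j` (zero when `j > i + 1`). For `n = 0` the empty determinant is `1`, so that
`D_0^{(s)} = 1 / s_0`. -/
def D (s : ℕ → 𝕜) (n : ℕ) : 𝕜 :=
  (1 / s 0 ^ (n + 1)) *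
    (Matrix.of fun i j : Fin n =>
      if (j : ℕ) ≤ (i : ℕ) + 1 then s ((i : ℕ) + 1 - (j : ℕ)) else 0).det

/-- The entry `e_{nk}` of the triangular matrix `E` attached to the sequence `a`. -/
def E (r s t a : ℕ → 𝕜) (n k : ℕ) : 𝕜 :=
  if k ≤ n then
    r k * (a k / (s 0 * t k)
      + (D s 0 / t k - D s 1 / t (k + 1)) * ∑ j ∈ Finset.Icc (k + 1) n, a j
      + ∑ l ∈ Finset.Icc (k + 2) n,
          (-1) ^ (l - k) * (D s (l - k) / t l) * ∑ j ∈ Finset.Icc l n, a j)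
  else 0

/-- `Γ₁(p)`; the index `L` runs over the positive integers, sums and suprema of nonnegative
quantities are taken in `[0, ∞]`. -/
def Gamma1 (r s t : ℕ → 𝕜) (p : ℕ → ℝ) : Set (ℕ → 𝕜) :=
  ⋃ L : ℕ+, {a | (⨆ n, ∑' k, ENNReal.ofReal (‖E r s t a n k‖ * (L : ℝ) ^ (-1 / p k))) < ⊤}

/-- `Γ₂(p)`; each row of `E` has only finitely many nonzero entries, so the series is a finite
sum. -/
def Gamma2 (r s t : ℕ → 𝕜) : Set (ℕ → 𝕜) :=
  {a | BddAbove (Set.range fun n => ‖∑' k, E r s t a n k‖)}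

/-- `Γ₃(p)`. -/
def Gamma3 (r s t : ℕ → 𝕜) (p : ℕ → ℝ) : Set (ℕ → 𝕜) :=
  ⋂ L : ℕ+, {a | (⨆ n, ∑' k, ENNReal.ofReal (‖E r s t a n k‖ * (L : ℝ) ^ (1 / p k))) < ⊤}

/-- `Γ₄(p)`. -/
def Gamma4 (r s t : ℕ → 𝕜) (p : ℕ → ℝ) : Set (ℕ → 𝕜) :=
  ⋃ L : ℕ+, {a | (⨆ n, ⨆ k, ENNReal.ofReal (‖E r s t a n k * (L : 𝕜)⁻¹‖ ^ p k)) < ⊤}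

/-- `Γ₅(p)`, with the conjugate exponents `p_k' = p_k / (p_k - 1)`. -/
def Gamma5 (r s t : ℕ → 𝕜) (p : ℕ → ℝ) : Set (ℕ → 𝕜) :=
  ⋃ L : ℕ+, {a | (⨆ n, ∑' k,
    ENNReal.ofReal (‖E r s t a n k * (L : 𝕜)⁻¹‖ ^ (p k / (p k - 1)))) < ⊤}

end

end GenMeans

/-!
Since `t (Δ x)` is recovered from the generalized mean `y` of `Δ x` by multiplication with the
power series `(∑ s_n X ^ n)⁻¹`, whose coefficients are `(-1) ^ n D_n` by Cramer's rule, summation by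
parts turns `∑_{k ≤ n} a_k x_k` into `∑_{k ≤ n} e_{nk} y_k`. Hence `a` lies in the `γ`-dual iff the
triangle `E` maps `X` into the bounded sequences. For this to happen, the sums `∑_k |e_{nk}| |v_k|`
must be bounded uniformly in `n` and in `v` over a suitable small solid set: otherwise one builds
`y ∈ X` out of finite pieces `v` whose phases and positions are chosen so that the `j`-th piece
dominates what the previous ones contribute. The sets are
`‖v_k‖ ^ p_k ≤ 1 / (j + 1)` for `c_0(p)`, `‖v_k‖ ^ p_k ≤ L` for `l_∞(p)` and
`∑ ‖v_k‖ ^ p_k ≤ 2⁻ʲ` for `l(p)`; their largest members, respectively the duality between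
`p` and `p'`, give the row conditions on `E`.
-/

namespace GenMeans

open Filter Topology Finset
open scoped Matrix PowerSeries

section Toeplitz

/-- The `n × n` lower triangular Toeplitz matrix of a sequence: the matrix of multiplication by the
power series `∑ s_i X ^ i` on the first `n` coefficients. -/
def toeplitz {R : Type*} [Zero R] (s : ℕ → R) (n : ℕ) : Matrix (Fin n) (Fin n) R :=
  Matrix.of fun i j => if (j : ℕ) ≤ i then s ((i : ℕ) - j) else 0

theorem det_toeplitz {R : Type*} [CommRing R] (s : ℕ → R) (n : ℕ) :
    (toeplitz s n).det = s 0 ^ n := by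
  rw [Matrix.det_of_isLowerTriangular]
  · simp [toeplitz]
  · intro i j hij
    have hij' : i < j := by simpa using hij
    simp [toeplitz, hij'.not_ge]

theorem coeff_mk_mul {R : Type*} [CommSemiring R] (s : ℕ → R) (f : R⟦X⟧) (n : ℕ) :
    PowerSeries.coeff n (PowerSeries.mk s * f) =
      ∑ k ∈ range (n + 1), s (n - k) * PowerSeries.coeff k f := by
  rw [mul_comm, PowerSeries.coeff_mul, Finset.Nat.sum_antidiagonal_eq_sum_range_succ_mk]
  simp only [PowerSeries.coeff_mk, mul_comm]

theorem toeplitz_mulVec_coeff {R : Type*} [CommSemiring R] (s : ℕ → R) (f : R⟦X⟧) (n : ℕ) :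
    (toeplitz s n *ᵥ fun i => PowerSeries.coeff i f) =
      fun i : Fin n => PowerSeries.coeff i (PowerSeries.mk s * f) := by
  ext i
  have hrange : (range n).filter (· ≤ (i : ℕ)) = range (i + 1) := by
    ext k
    simp only [mem_filter, mem_range]
    omega
  rw [coeff_mk_mul, ← hrange, sum_filter, ← Fin.sum_univ_eq_sum_range
    (fun k => if k ≤ (i : ℕ) then s (i - k) * PowerSeries.coeff k f else 0)]
  simp only [Matrix.mulVec, dotProduct, toeplitz, Matrix.of_apply, ite_mul, zero_mul]

/-- **Wronski's formula**: Cramer's rule for the Toeplitz system whose solution is the inverse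
power series. -/
theorem coeff_inv_mk {F : Type*} [Field F] {s : ℕ → F} (hs : s 0 ≠ 0) (n : ℕ) :
    PowerSeries.coeff n (PowerSeries.mk s)⁻¹ =
      (-1) ^ n * (1 / s 0 ^ (n + 1) *
        ((toeplitz s (n + 1)).submatrix Fin.succ Fin.castSucc).det) := by
  set T := toeplitz s (n + 1)
  set u : Fin (n + 1) → F := fun i => PowerSeries.coeff i (PowerSeries.mk s)⁻¹
  have hTu : T *ᵥ u = Pi.single 0 1 := by
    rw [toeplitz_mulVec_coeff, PowerSeries.mul_inv_cancel _ (by simpa using hs)]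
    ext i
    simp only [PowerSeries.coeff_one, Pi.single_apply, Fin.ext_iff, Fin.val_zero]
  have hcramer : T.adjugate *ᵥ Pi.single 0 1 = T.det • u := by
    rw [← hTu, Matrix.mulVec_mulVec, Matrix.adjugate_mul, Matrix.smul_mulVec, Matrix.one_mulVec]
  have hlast := congrFun hcramer (Fin.last n)
  rw [Matrix.mulVec_single_one, Matrix.col_apply, Matrix.adjugate_fin_succ_eq_det_submatrix,
    det_toeplitz, Fin.succAbove_zero, Fin.succAbove_last] at hlast
  simp only [Fin.val_zero, Fin.val_last, zero_add, Pi.smul_apply, smul_eq_mul, u] at hlast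
  rw [mul_left_comm, hlast, ← mul_assoc, one_div_mul_cancel (pow_ne_zero _ hs), one_mul]

end Toeplitz

variable {𝕜 : Type*} [RCLike 𝕜]

section Inverse

variable {r s t : ℕ → 𝕜}

theorem D_eq_det_submatrix_toeplitz (s : ℕ → 𝕜) (n : ℕ) :
    D s n = 1 / s 0 ^ (n + 1) *
      ((toeplitz s (n + 1)).submatrix Fin.succ Fin.castSucc).det := by
  simp only [D, toeplitz, Matrix.submatrix, Matrix.of_apply, Fin.val_succ, Fin.val_castSucc]

theorem inv_mk_eq_mk_D (hs : s 0 ≠ 0) :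
    (PowerSeries.mk s)⁻¹ = PowerSeries.mk fun n => (-1) ^ n * D s n := by
  ext n
  rw [coeff_inv_mk hs, PowerSeries.coeff_mk, D_eq_det_submatrix_toeplitz]

/-- The inverse of the triangular transformation `genMean r s t`. -/
noncomputable def invMean (r s t y : ℕ → 𝕜) (l : ℕ) : 𝕜 :=
  1 / t l * ∑ k ∈ range (l + 1), (-1) ^ (l - k) * D s (l - k) * (r k * y k)

theorem mk_mul_genMean (hr : ∀ n, r n ≠ 0) (x : ℕ → 𝕜) :
    (PowerSeries.mk fun n => r n * genMean r s t x n) =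
      PowerSeries.mk s * PowerSeries.mk fun k => t k * x k := by
  ext n
  simp only [coeff_mk_mul, PowerSeries.coeff_mk, genMean, ← mul_assoc, mul_one_div_cancel (hr n),
    one_mul]

theorem mk_mul_invMean (ht : ∀ n, t n ≠ 0) (hs : s 0 ≠ 0) (y : ℕ → 𝕜) :
    (PowerSeries.mk fun n => t n * invMean r s t y n) =
      (PowerSeries.mk s)⁻¹ * PowerSeries.mk fun k => r k * y k := by
  ext n
  rw [inv_mk_eq_mk_D hs, coeff_mk_mul]
  simp only [PowerSeries.coeff_mk, invMean, ← mul_assoc, mul_one_div_cancel (ht n), one_mul]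

theorem genMean_invMean (hr : ∀ n, r n ≠ 0) (ht : ∀ n, t n ≠ 0) (hs : s 0 ≠ 0) (y : ℕ → 𝕜) :
    genMean r s t (invMean r s t y) = y := by
  have h := mk_mul_genMean (s := s) (t := t) hr (invMean r s t y)
  rw [mk_mul_invMean ht hs, ← mul_assoc, PowerSeries.mul_inv_cancel _ (by simpa using hs),
    one_mul, PowerSeries.ext_iff] at h
  ext n
  exact mul_left_cancel₀ (hr n) (by simpa only [PowerSeries.coeff_mk] using h n)

theorem invMean_genMean (hr : ∀ n, r n ≠ 0) (ht : ∀ n, t n ≠ 0) (hs : s 0 ≠ 0) (x : ℕ → 𝕜) :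
    invMean r s t (genMean r s t x) = x := by
  have h := mk_mul_invMean (r := r) ht hs (genMean r s t x)
  rw [mk_mul_genMean hr, ← mul_assoc, PowerSeries.inv_mul_cancel _ (by simpa using hs),
    one_mul, PowerSeries.ext_iff] at h
  ext n
  exact mul_left_cancel₀ (ht n) (by simpa only [PowerSeries.coeff_mk] using h n)

end Inverse

section GammaDual

theorem sum_range_diff (x : ℕ → 𝕜) (n : ℕ) : ∑ l ∈ range (n + 1), diff x l = x n := by
  induction n with
  | zero => simp [diff]
  | succ n ih => rw [sum_range_succ, ih, diff, add_sub_cancel]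

theorem diff_sum_range (d : ℕ → 𝕜) : diff (fun n => ∑ l ∈ range (n + 1), d l) = d := by
  ext (_ | n)
  · simp [diff]
  · simp [diff, sum_range_succ _ (n + 1)]

theorem sum_mul_eq_sum_diff_mul_sum_Icc (a x : ℕ → 𝕜) (n : ℕ) :
    ∑ m ∈ range (n + 1), a m * x m =
      ∑ l ∈ range (n + 1), diff x l * ∑ m ∈ Icc l n, a m := by
  calc ∑ m ∈ range (n + 1), a m * x m
      = ∑ m ∈ range (n + 1), ∑ l ∈ range (m + 1), diff x l * a m := by
        refine sum_congr rfl fun m _ => ?_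
        rw [← sum_mul, sum_range_diff, mul_comm]
    _ = ∑ l ∈ range (n + 1), ∑ m ∈ Icc l n, diff x l * a m :=
        sum_comm' fun m l => by simp only [mem_range, mem_Icc]; omega
    _ = _ := by simp only [mul_sum]

theorem E_eq_mul_sum_Icc (r s t a : ℕ → 𝕜) {n k : ℕ} (h : k ≤ n) :
    E r s t a n k =
      r k * ∑ l ∈ Icc k n, (-1) ^ (l - k) * (D s (l - k) / t l) * ∑ j ∈ Icc l n, a j := by
  have hD : D s 0 = 1 / s 0 := by simp [D]
  have hIcc {m : ℕ} (hm : m ≤ n) (f : ℕ → 𝕜) :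
      ∑ l ∈ Icc m n, f l = f m + ∑ l ∈ Icc (m + 1) n, f l := by
    rw [← insert_Icc_add_one_left_eq_Icc hm, sum_insert (by simp)]
  rw [E, if_pos h, hIcc h, hIcc h a, Nat.sub_self, hD]
  rcases h.eq_or_lt with rfl | hlt
  · simp [div_eq_mul_inv, mul_comm]
  · rw [hIcc hlt fun l => (-1) ^ (l - k) * (D s (l - k) / t l) * ∑ j ∈ Icc l n, a j,
      Nat.succ_eq_add_one, Nat.add_sub_cancel_left]
    simp only [pow_zero, pow_one, one_mul, div_eq_mul_inv, mul_inv]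
    ring

theorem E_eq_zero (r s t a : ℕ → 𝕜) {n k : ℕ} (h : n < k) : E r s t a n k = 0 :=
  if_neg h.not_ge

theorem sum_mul_eq_sum_E_mul_genMean {r s t : ℕ → 𝕜} (hr : ∀ n, r n ≠ 0) (ht : ∀ n, t n ≠ 0)
    (hs : s 0 ≠ 0) (a x : ℕ → 𝕜) (n : ℕ) :
    ∑ m ∈ range (n + 1), a m * x m =
      ∑ k ∈ range (n + 1), E r s t a n k * genMean r s t (diff x) k := by
  set y := genMean r s t (diff x)
  have hdiff : diff x = invMean r s t y := (invMean_genMean hr ht hs _).symm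
  calc ∑ m ∈ range (n + 1), a m * x m
      = ∑ l ∈ range (n + 1), ∑ k ∈ range (l + 1),
          (-1) ^ (l - k) * (D s (l - k) / t l) * (r k * y k) * ∑ j ∈ Icc l n, a j := by
        rw [sum_mul_eq_sum_diff_mul_sum_Icc, hdiff]
        refine sum_congr rfl fun l _ => ?_
        rw [invMean, mul_assoc, sum_mul, mul_sum]
        exact sum_congr rfl fun k _ => by ring
    _ = ∑ k ∈ range (n + 1), ∑ l ∈ Icc k n,
          (-1) ^ (l - k) * (D s (l - k) / t l) * (r k * y k) * ∑ j ∈ Icc l n, a j :=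
        sum_comm' fun l k => by simp only [mem_range, mem_Icc]; omega
    _ = ∑ k ∈ range (n + 1), E r s t a n k * y k := by
        refine sum_congr rfl fun k hk => ?_
        rw [E_eq_mul_sum_Icc r s t a (mem_range_succ_iff.1 hk), mul_sum, sum_mul]
        exact sum_congr rfl fun l _ => by ring

/-- The matrix class `(X, ℓ_∞)` for triangles: the rows of `A` are cut off at the diagonal, so that
its entries above the diagonal play no role. -/
def MapsToBounded (A : ℕ → ℕ → 𝕜) (X : Set (ℕ → 𝕜)) : Prop :=
  ∀ y ∈ X, BddAbove (Set.range fun n => ‖∑ k ∈ range (n + 1), A n k * y k‖)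

theorem mem_gammaDual_meanDiffSpace_iff {r s t : ℕ → 𝕜} (hr : ∀ n, r n ≠ 0)
    (ht : ∀ n, t n ≠ 0) (hs : s 0 ≠ 0) {X : Set (ℕ → 𝕜)} {a : ℕ → 𝕜} :
    a ∈ gammaDual (meanDiffSpace X r s t) ↔ MapsToBounded (E r s t a) X := by
  have hdual : a ∈ gammaDual (meanDiffSpace X r s t) ↔ ∀ x, genMean r s t (diff x) ∈ X →
      BddAbove (Set.range fun n =>
        ‖∑ k ∈ range (n + 1), E r s t a n k * genMean r s t (diff x) k‖) := by
    simp only [← sum_mul_eq_sum_E_mul_genMean hr ht hs]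
    exact Iff.rfl
  rw [hdual]
  refine ⟨fun h y hy => ?_, fun h x => h _⟩
  have hxy := h fun n => ∑ l ∈ range (n + 1), invMean r s t y l
  rw [diff_sum_range, genMean_invMean hr ht hs] at hxy
  exact hxy hy

end GammaDual

section GlidingHump

variable {A : ℕ → ℕ → 𝕜} {X : Set (ℕ → 𝕜)} {V : ℕ → Set (ℕ → 𝕜)}

/-- A gliding hump family for `X`: solid sets `V j` of sequences, coordinatewise bounded uniformly
in `j`, such that `X` contains every sequence obtained by gluing members of `V 0, V 1, …` along
consecutive finite blocks of indices. -/
structure IsGlidingHumpFamily (V : ℕ → Set (ℕ → 𝕜)) (X : Set (ℕ → 𝕜)) : Prop where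
  solid : ∀ {j : ℕ} {v w : ℕ → 𝕜}, v ∈ V j → (∀ k, ‖w k‖ ≤ ‖v k‖) → w ∈ V j
  bounded : ∀ k, ∃ b : ℝ, ∀ j, ∀ v ∈ V j, ‖v k‖ ≤ b
  glue : ∀ {N : ℕ → ℕ} {y : ℕ → 𝕜}, StrictMono N → N 0 = 0 →
    (∀ j, (Set.Ico (N j) (N (j + 1))).indicator y ∈ V j) → y ∈ X

theorem exists_mem_Ico_of_strictMono {N : ℕ → ℕ} (hN : StrictMono N) (hN0 : N 0 = 0) (k : ℕ) :
    ∃ j, k ∈ Set.Ico (N j) (N (j + 1)) := by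
  have hcover := iUnion_Ico_map_succ_eq_Ici (fun n => hN.monotone (Nat.zero_le n))
    (Set.infinite_range_of_injective hN.injective).not_bddAbove
  have hk : k ∈ Set.Ici (N ⊥) := by simp [hN0]
  rw [← hcover] at hk
  exact Set.mem_iUnion.1 hk

theorem exists_eq_on_Ico_of_strictMono {α : Type*} {N : ℕ → ℕ} (hN : StrictMono N)
    (hN0 : N 0 = 0) (v : ℕ → ℕ → α) :
    ∃ y : ℕ → α, ∀ j, ∀ k ∈ Set.Ico (N j) (N (j + 1)), y k = v j k := by
  choose J hJ using exists_mem_Ico_of_strictMono hN hN0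
  refine ⟨fun k => v (J k) k, fun j k hk => ?_⟩
  have hJk : J k = j := by
    by_contra hne
    exact Set.disjoint_left.1 (hN.monotone.pairwise_disjoint_on_Ico_succ hne) (hJ k) hk
  exact congrArg (v · k) hJk

theorem MapsToBounded.exists_column_bound (hA : MapsToBounded A X)
    (hX : ∀ k, (Pi.single k 1 : ℕ → 𝕜) ∈ X) :
    ∃ C : ℕ → ℝ, ∀ n, ∀ k ≤ n, ‖A n k‖ ≤ C k := by
  choose C hC using fun k => hA _ (hX k)
  refine ⟨C, fun n k hk => ?_⟩
  have hCk := hC k ⟨n, rfl⟩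
  simpa only [Pi.single_apply, mul_ite, mul_one, mul_zero, sum_ite_eq', mem_range_succ_iff, hk,
    if_true] using hCk

theorem exists_lt_norm_sum_Ico {W : Set (ℕ → 𝕜)} {C b : ℕ → ℝ}
    (hC : ∀ n, ∀ k ≤ n, ‖A n k‖ ≤ C k)
    (hW : ∀ {v w : ℕ → 𝕜}, v ∈ W → (∀ k, ‖w k‖ ≤ ‖v k‖) → w ∈ W) (hb : ∀ v ∈ W, ∀ k, ‖v k‖ ≤ b k)
    (hunb : ∀ M : ℝ, ∃ v ∈ W, ∃ n, M < ∑ k ∈ range (n + 1), ‖A n k‖ * ‖v k‖)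
    (m : ℕ) {M : ℝ} (hM : 0 ≤ M) :
    ∃ n ≥ m, ∃ v ∈ W, M < ‖∑ k ∈ Ico m (n + 1), A n k * v k‖ := by
  obtain ⟨v, hv, n, hn⟩ := hunb (∑ k ∈ range m, C k * b k + M)
  have hterm {k : ℕ} (hk : k ≤ n) : ‖A n k‖ * ‖v k‖ ≤ C k * b k :=
    mul_le_mul (hC n k hk) (hb v hv k) (norm_nonneg _) ((norm_nonneg _).trans (hC n k hk))
  have hCb (k : ℕ) : 0 ≤ C k * b k :=
    mul_nonneg ((norm_nonneg _).trans (hC k k le_rfl)) ((norm_nonneg _).trans (hb v hv k))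
  have hmn : m ≤ n := by
    by_contra! hlt
    have hle : ∑ k ∈ range (n + 1), ‖A n k‖ * ‖v k‖ ≤ ∑ k ∈ range m, C k * b k :=
      (sum_le_sum fun k hk => hterm (mem_range_succ_iff.1 hk)).trans
        (sum_le_sum_of_subset_of_nonneg (range_mono hlt) fun k _ _ => hCb k)
    linarith
  have hhead : ∑ k ∈ range m, ‖A n k‖ * ‖v k‖ ≤ ∑ k ∈ range m, C k * b k :=
    sum_le_sum fun k hk => hterm ((mem_range.1 hk).le.trans hmn)
  choose u hu_norm hu using fun k => RCLike.exists_norm_eq_mul_self (A n k)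
  refine ⟨n, hmn, fun k => u k * (‖v k‖ : 𝕜), hW hv fun k => ?_, ?_⟩
  · rw [norm_mul, hu_norm, one_mul, RCLike.norm_ofReal, abs_norm]
  · have hphase : ∑ k ∈ Ico m (n + 1), A n k * (u k * (‖v k‖ : 𝕜)) =
        ((∑ k ∈ Ico m (n + 1), ‖A n k‖ * ‖v k‖ : ℝ) : 𝕜) := by
      rw [RCLike.ofReal_sum]
      refine sum_congr rfl fun k _ => ?_
      rw [RCLike.ofReal_mul, hu]
      ring
    rw [hphase, RCLike.norm_ofReal]
    rw [← sum_range_add_sum_Ico _ (hmn.trans n.le_succ)] at hn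
    exact lt_of_lt_of_le (by linarith) (le_abs_self _)

theorem not_bddAbove_of_forall_lt_norm_sum_Ico {C b : ℕ → ℝ} {y : ℕ → 𝕜}
    (hC : ∀ n, ∀ k ≤ n, ‖A n k‖ ≤ C k) (hy : ∀ k, ‖y k‖ ≤ b k)
    (h : ∀ j : ℕ, ∃ m n, m ≤ n ∧
      ∑ k ∈ range m, C k * b k + j < ‖∑ k ∈ Ico m (n + 1), A n k * y k‖) :
    ¬ BddAbove (Set.range fun n => ‖∑ k ∈ range (n + 1), A n k * y k‖) := by
  rintro ⟨K, hK⟩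
  obtain ⟨j, hj⟩ := exists_nat_gt K
  obtain ⟨m, n, hmn, hhump⟩ := h j
  have hrow : ‖∑ k ∈ range m, A n k * y k + ∑ k ∈ Ico m (n + 1), A n k * y k‖ ≤ K := by
    rw [sum_range_add_sum_Ico _ (hmn.trans n.le_succ)]
    exact hK ⟨n, rfl⟩
  have hhead : ‖∑ k ∈ range m, A n k * y k‖ ≤ ∑ k ∈ range m, C k * b k := by
    refine norm_sum_le_of_le _ fun k hk => ?_
    have hCk := hC n k ((mem_range.1 hk).le.trans hmn)
    rw [norm_mul]
    exact mul_le_mul hCk (hy k) (norm_nonneg _) ((norm_nonneg _).trans hCk)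
  have htri := norm_sub_le_norm_add (∑ k ∈ Ico m (n + 1), A n k * y k)
    (∑ k ∈ range m, A n k * y k)
  rw [add_comm] at hrow
  linarith

/-- **Gliding hump principle**: the hump used at stage `j` outweighs by `j` everything that earlier
blocks can contribute, so the glued sequence has unbounded row sums. -/
theorem MapsToBounded.exists_sum_norm_mul_norm_le (hA : MapsToBounded A X)
    (hX : ∀ k, (Pi.single k 1 : ℕ → 𝕜) ∈ X) (hV : IsGlidingHumpFamily V X) :
    ∃ (j : ℕ) (M : ℝ), ∀ v ∈ V j, ∀ n, ∑ k ∈ range (n + 1), ‖A n k‖ * ‖v k‖ ≤ M := by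
  by_contra! hunb
  obtain ⟨C, hC⟩ := hA.exists_column_bound hX
  choose b hb using hV.bounded
  have hbound_nonneg (m j : ℕ) : 0 ≤ ∑ k ∈ range m, C k * b k + (j : ℝ) := by
    obtain ⟨v, hv, -⟩ := hunb 0 0
    exact add_nonneg (sum_nonneg fun k _ => mul_nonneg ((norm_nonneg _).trans (hC k k le_rfl))
      ((norm_nonneg _).trans (hb k 0 v hv))) j.cast_nonneg
  choose n hmn v hv hhump using fun j m => exists_lt_norm_sum_Ico hC hV.solid
    (fun v hv k => hb k j v hv) (hunb j) m (hbound_nonneg m j)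
  let N : ℕ → ℕ := fun j => Nat.rec 0 (fun j m => n j m + 1) j
  have hN : StrictMono N := strictMono_nat_of_lt_succ fun j => Nat.lt_succ_of_le (hmn j (N j))
  obtain ⟨y, hy⟩ := exists_eq_on_Ico_of_strictMono hN rfl fun j => v j (N j)
  have hyX : y ∈ X := by
    refine hV.glue hN rfl fun j => hV.solid (hv j (N j)) fun k => ?_
    rcases em (k ∈ Set.Ico (N j) (N (j + 1))) with hk | hk
    · rw [Set.indicator_of_mem hk, hy j k hk]
    · rw [Set.indicator_of_notMem hk, norm_zero]
      exact norm_nonneg _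
  have hyb (k : ℕ) : ‖y k‖ ≤ b k := by
    obtain ⟨j, hj⟩ := exists_mem_Ico_of_strictMono hN rfl k
    rw [hy j k hj]
    exact hb k j _ (hv j (N j))
  refine not_bddAbove_of_forall_lt_norm_sum_Ico hC hyb
    (fun j => ⟨N j, n j (N j), hmn j (N j), (hhump j (N j)).trans_eq ?_⟩) (hA y hyX)
  exact congrArg _ (sum_congr rfl fun k hk => by rw [hy j k (mem_Ico.1 hk)])

theorem mapsToBounded_of_forall_exists_sum_norm_le
    (h : ∀ y ∈ X, ∃ M : ℝ, ∀ n, ∑ k ∈ range (n + 1), ‖A n k‖ * ‖y k‖ ≤ M) :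
    MapsToBounded A X := by
  intro y hy
  obtain ⟨M, hM⟩ := h y hy
  refine ⟨M, Set.forall_mem_range.2 fun n => (norm_sum_le _ _).trans ?_⟩
  simpa only [norm_mul] using hM n

end GlidingHump

section Maddox

variable {A : ℕ → ℕ → 𝕜} {p : ℕ → ℝ}

theorem single_mem_maddoxC0 (hp : ∀ k, 0 < p k) (i : ℕ) :
    (Pi.single i 1 : ℕ → 𝕜) ∈ maddoxC0 p := by
  refine tendsto_const_nhds.congr' ?_
  filter_upwards [eventually_gt_atTop i] with k hk
  rw [Pi.single_eq_of_ne hk.ne', norm_zero, Real.zero_rpow (hp k).ne']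

theorem single_mem_maddoxLinf (hp : ∀ k, 0 < p k) (i : ℕ) :
    (Pi.single i 1 : ℕ → 𝕜) ∈ maddoxLinf p :=
  Tendsto.bddAbove_range (single_mem_maddoxC0 hp i)

theorem single_mem_maddoxL (hp : ∀ k, 0 < p k) (i : ℕ) :
    (Pi.single i 1 : ℕ → 𝕜) ∈ maddoxL p := by
  refine summable_of_ne_finset_zero (s := {i}) fun k hk => ?_
  rw [Pi.single_eq_of_ne (notMem_singleton.1 hk), norm_zero, Real.zero_rpow (hp k).ne']

theorem le_rpow_inv_of_rpow_le {x y q : ℝ} (hx : 0 ≤ x) (hq : 0 < q) (h : x ^ q ≤ y) :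
    x ≤ y ^ q⁻¹ :=
  (Real.le_rpow_inv_iff_of_pos hx ((Real.rpow_nonneg hx q).trans h) hq).2 h

theorem rpow_neg_one_div {x : ℝ} (hx : 0 ≤ x) (q : ℝ) : x ^ (-1 / q) = x⁻¹ ^ q⁻¹ := by
  rw [neg_div, one_div, Real.rpow_neg hx, Real.inv_rpow hx]

theorem isGlidingHumpFamily_maddoxC0 (hp : ∀ k, 0 < p k) :
    IsGlidingHumpFamily (fun j : ℕ => {v : ℕ → 𝕜 | ∀ k, ‖v k‖ ^ p k ≤ ((j : ℝ) + 1)⁻¹})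
      (maddoxC0 p) where
  solid hv hw k := (Real.rpow_le_rpow (norm_nonneg _) (hw k) (hp k).le).trans (hv k)
  bounded k := by
    refine ⟨1, fun j v hv => ?_⟩
    have hle : ‖v k‖ ^ p k ≤ 1 :=
      (hv k).trans (inv_le_one_of_one_le₀ (le_add_of_nonneg_left j.cast_nonneg))
    exact (le_rpow_inv_of_rpow_le (norm_nonneg _) (hp k) hle).trans_eq (Real.one_rpow _)
  glue {N y} hN hN0 hy := by
    refine Metric.tendsto_atTop.2 fun ε hε => ?_
    obtain ⟨J, hJ⟩ := exists_nat_one_div_lt hε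
    refine ⟨N J, fun k hk => ?_⟩
    obtain ⟨j, hj⟩ := exists_mem_Ico_of_strictMono hN hN0 k
    have hJj : J ≤ j := Nat.lt_succ_iff.1 (hN.lt_iff_lt.1 (hk.trans_lt hj.2))
    have hyk := hy j k
    rw [Set.indicator_of_mem hj] at hyk
    rw [Real.dist_eq, sub_zero, abs_of_nonneg (by positivity)]
    calc ‖y k‖ ^ p k ≤ ((j : ℝ) + 1)⁻¹ := hyk
      _ ≤ 1 / ((J : ℝ) + 1) := by rw [one_div]; gcongr
      _ < ε := hJ

theorem exists_norm_le_mul_of_mem_maddoxC0 (hp : ∀ k, 0 < p k) {y : ℕ → 𝕜}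
    (hy : y ∈ maddoxC0 p) {L : ℝ} (hL : 0 < L) :
    ∃ C > 0, ∀ k, ‖y k‖ ≤ C * L ^ (-1 / p k) := by
  have hpos (k : ℕ) : 0 < L ^ (-1 / p k) := Real.rpow_pos_of_pos hL _
  have hO : y =O[atTop] fun k => L ^ (-1 / p k) := by
    refine Asymptotics.IsBigO.of_bound 1 ?_
    filter_upwards [Tendsto.eventually_le_const (inv_pos.2 hL) hy] with k hk
    rw [one_mul, Real.norm_of_nonneg (hpos k).le, rpow_neg_one_div hL.le]
    exact le_rpow_inv_of_rpow_le (norm_nonneg _) (hp k) hk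
  obtain ⟨C, hC, hyC⟩ := Asymptotics.bound_of_isBigO_nat_atTop hO
  refine ⟨C, hC, fun k => (hyC (hpos k).ne').trans_eq ?_⟩
  rw [Real.norm_of_nonneg (hpos k).le]

theorem mapsToBounded_maddoxC0_iff (hp : ∀ k, 0 < p k) :
    MapsToBounded A (maddoxC0 p) ↔ ∃ (L : ℕ+) (M : ℝ), ∀ n,
      ∑ k ∈ range (n + 1), ‖A n k‖ * (L : ℝ) ^ (-1 / p k) ≤ M := by
  constructor
  · intro hA
    obtain ⟨j, M, hM⟩ := hA.exists_sum_norm_mul_norm_le (single_mem_maddoxC0 hp)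
      (isGlidingHumpFamily_maddoxC0 hp)
    have hL : (j.succPNat : ℝ) = j + 1 := by rw [Nat.succPNat_coe, Nat.cast_succ]
    have hj : (0 : ℝ) ≤ j + 1 := by positivity
    have hnorm (k : ℕ) : ‖((((j : ℝ) + 1)⁻¹ ^ (p k)⁻¹ : ℝ) : 𝕜)‖ = ((j : ℝ) + 1)⁻¹ ^ (p k)⁻¹ :=
      RCLike.norm_of_nonneg (by positivity)
    refine ⟨j.succPNat, M, fun n => ?_⟩
    have hrow := hM (fun k => (((j : ℝ) + 1)⁻¹ ^ (p k)⁻¹ : ℝ)) (fun k => by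
      rw [hnorm, Real.rpow_inv_rpow (by positivity) (hp k).ne']) n
    simpa only [hnorm, hL, rpow_neg_one_div hj] using hrow
  · rintro ⟨L, M, hM⟩
    refine mapsToBounded_of_forall_exists_sum_norm_le fun y hy => ?_
    obtain ⟨C, hC, hyC⟩ :=
      exists_norm_le_mul_of_mem_maddoxC0 hp hy (L := L) (by exact_mod_cast L.pos)
    refine ⟨C * M, fun n => ?_⟩
    calc ∑ k ∈ range (n + 1), ‖A n k‖ * ‖y k‖
        ≤ ∑ k ∈ range (n + 1), C * (‖A n k‖ * (L : ℝ) ^ (-1 / p k)) :=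
          sum_le_sum fun k _ =>
            (mul_le_mul_of_nonneg_left (hyC k) (norm_nonneg _)).trans_eq (mul_left_comm _ _ _)
      _ ≤ C * M := by
          rw [← mul_sum]
          exact mul_le_mul_of_nonneg_left (hM n) hC.le

theorem mapsToBounded_maddoxC_iff (hp : ∀ k, 0 < p k) :
    MapsToBounded A (maddoxC p) ↔ MapsToBounded A (maddoxC0 p) ∧
      BddAbove (Set.range fun n => ‖∑ k ∈ range (n + 1), A n k‖) := by
  constructor
  · intro hA
    have hone : (fun _ => 1 : ℕ → 𝕜) ∈ maddoxC p :=
      ⟨1, by simp only [sub_self, norm_zero, Real.zero_rpow (hp _).ne', tendsto_const_nhds]⟩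
    refine ⟨fun y hy => hA y ⟨0, ?_⟩, ?_⟩
    · simp only [sub_zero]
      exact hy
    · simpa only [mul_one] using hA _ hone
  · rintro ⟨hA, B, hB⟩ y ⟨l, hl⟩
    obtain ⟨M, hM⟩ := hA (fun k => y k - l) hl
    refine ⟨M + B * ‖l‖, Set.forall_mem_range.2 fun n => ?_⟩
    have hsplit : ∑ k ∈ range (n + 1), A n k * y k =
        ∑ k ∈ range (n + 1), A n k * (y k - l) + (∑ k ∈ range (n + 1), A n k) * l := by
      simp only [mul_sub, sum_sub_distrib, sum_mul, sub_add_cancel]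
    rw [hsplit]
    refine (norm_add_le _ _).trans (add_le_add (hM ⟨n, rfl⟩) ?_)
    rw [norm_mul]
    exact mul_le_mul_of_nonneg_right (hB ⟨n, rfl⟩) (norm_nonneg _)

theorem isGlidingHumpFamily_maddoxLinf (hp : ∀ k, 0 < p k) (M : ℝ) :
    IsGlidingHumpFamily (fun _ => {v : ℕ → 𝕜 | ∀ k, ‖v k‖ ^ p k ≤ M}) (maddoxLinf p) where
  solid hv hw k := (Real.rpow_le_rpow (norm_nonneg _) (hw k) (hp k).le).trans (hv k)
  bounded k := ⟨M ^ (p k)⁻¹, fun _ _ hv => le_rpow_inv_of_rpow_le (norm_nonneg _) (hp k) (hv k)⟩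
  glue {N y} hN hN0 hy := by
    refine ⟨M, Set.forall_mem_range.2 fun k => ?_⟩
    obtain ⟨j, hj⟩ := exists_mem_Ico_of_strictMono hN hN0 k
    simpa only [Set.indicator_of_mem hj] using hy j k

theorem mapsToBounded_maddoxLinf_iff (hp : ∀ k, 0 < p k) :
    MapsToBounded A (maddoxLinf p) ↔ ∀ L : ℕ+, ∃ M : ℝ, ∀ n,
      ∑ k ∈ range (n + 1), ‖A n k‖ * (L : ℝ) ^ (1 / p k) ≤ M := by
  simp only [one_div]
  constructor
  · intro hA L
    obtain ⟨-, M, hM⟩ := hA.exists_sum_norm_mul_norm_le (single_mem_maddoxLinf hp)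
      (isGlidingHumpFamily_maddoxLinf hp (L : ℝ))
    have hnorm (k : ℕ) : ‖(((L : ℝ) ^ (p k)⁻¹ : ℝ) : 𝕜)‖ = (L : ℝ) ^ (p k)⁻¹ :=
      RCLike.norm_of_nonneg (by positivity)
    refine ⟨M, fun n => ?_⟩
    have hrow := hM (fun k => ((L : ℝ) ^ (p k)⁻¹ : ℝ)) (fun k => by
      rw [hnorm, Real.rpow_inv_rpow (by positivity) (hp k).ne']) n
    simpa only [hnorm] using hrow
  · refine fun h => mapsToBounded_of_forall_exists_sum_norm_le ?_
    rintro y ⟨K, hK⟩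
    obtain ⟨m, hm⟩ := exists_nat_ge K
    obtain ⟨M, hM⟩ := h m.succPNat
    refine ⟨M, fun n => (sum_le_sum fun k _ => ?_).trans (hM n)⟩
    have hKL : K ≤ (m.succPNat : ℝ) := hm.trans (by exact_mod_cast m.le_succ)
    exact mul_le_mul_of_nonneg_left
      (le_rpow_inv_of_rpow_le (norm_nonneg _) (hp k) ((hK ⟨k, rfl⟩).trans hKL)) (norm_nonneg _)

/-- The ball `{v | ∑ ‖v k‖ ^ p k ≤ δ}` of the modular of `l(p)`; bounding the finite partial sums
avoids the junk value of a divergent series. -/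
def modularBall (p : ℕ → ℝ) (δ : ℝ) : Set (ℕ → 𝕜) :=
  {v | ∀ u : Finset ℕ, ∑ k ∈ u, ‖v k‖ ^ p k ≤ δ}

theorem indicator_mem_modularBall (hp : ∀ k, 0 < p k) {u : Finset ℕ} {w : ℕ → ℝ}
    (hw : ∀ k, 0 ≤ w k) {δ : ℝ} (h : ∑ k ∈ u, w k ^ p k ≤ δ) :
    (u : Set ℕ).indicator (fun k => (w k : 𝕜)) ∈ modularBall p δ := by
  intro u'
  have hterm (k : ℕ) : ‖(u : Set ℕ).indicator (fun k => (w k : 𝕜)) k‖ ^ p k =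
      (u : Set ℕ).indicator (fun k => w k ^ p k) k := by
    by_cases hk : k ∈ (u : Set ℕ)
    · rw [Set.indicator_of_mem hk, Set.indicator_of_mem hk, RCLike.norm_of_nonneg (hw k)]
    · rw [Set.indicator_of_notMem hk, Set.indicator_of_notMem hk, norm_zero,
        Real.zero_rpow (hp k).ne']
  rw [sum_congr rfl fun k _ => hterm k, sum_indicator_eq_sum_inter]
  exact (sum_le_sum_of_subset_of_nonneg inter_subset_right
    fun k _ _ => Real.rpow_nonneg (hw k) _).trans h

theorem isGlidingHumpFamily_maddoxL (hp : ∀ k, 0 < p k) :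
    IsGlidingHumpFamily (fun j => modularBall (𝕜 := 𝕜) p ((1 / 2) ^ j)) (maddoxL p) where
  solid hv hw u := (sum_le_sum fun k _ =>
    Real.rpow_le_rpow (norm_nonneg _) (hw k) (hp k).le).trans (hv u)
  bounded k := by
    refine ⟨1, fun j v hv => ?_⟩
    have hle : ‖v k‖ ^ p k ≤ 1 := by
      simpa only [sum_singleton] using
        (hv {k}).trans (pow_le_one₀ (by norm_num) (by norm_num))
    exact (le_rpow_inv_of_rpow_le (norm_nonneg _) (hp k) hle).trans_eq (Real.one_rpow _)
  glue {N y} hN hN0 hy := by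
    have hblock (j : ℕ) : ∑ k ∈ Ico (N j) (N (j + 1)), ‖y k‖ ^ p k ≤ (1 / 2) ^ j := by
      refine (sum_congr rfl fun k hk => ?_).trans_le (hy j (Ico (N j) (N (j + 1))))
      rw [Set.indicator_of_mem (Set.mem_Ico.2 (mem_Ico.1 hk))]
    have hsum (J : ℕ) : ∑ k ∈ range (N J), ‖y k‖ ^ p k ≤ ∑ j ∈ range J, (1 / 2 : ℝ) ^ j := by
      induction J with
      | zero => simp [hN0]
      | succ J ih =>
        rw [← sum_range_add_sum_Ico _ (hN.monotone J.le_succ), sum_range_succ _ J]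
        exact add_le_add ih (hblock J)
    refine summable_of_sum_range_le (c := 2) (fun k => by positivity) fun n => ?_
    calc ∑ k ∈ range n, ‖y k‖ ^ p k ≤ ∑ k ∈ range (N n), ‖y k‖ ^ p k :=
          sum_le_sum_of_subset_of_nonneg (range_mono (hN.id_le n)) fun k _ _ => by positivity
      _ ≤ ∑ j ∈ range n, (1 / 2 : ℝ) ^ j := hsum n
      _ ≤ 2 := sum_geometric_two_le n

theorem MapsToBounded.exists_sum_norm_mul_le_of_sum_rpow_le (hp : ∀ k, 0 < p k)
    (hA : MapsToBounded A (maddoxL p)) :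
    ∃ (δ M : ℝ), 0 < δ ∧ δ ≤ 1 ∧ ∀ (w : ℕ → ℝ), (∀ k, 0 ≤ w k) → ∀ n, ∀ u ⊆ range (n + 1),
      ∑ k ∈ u, w k ^ p k ≤ δ → ∑ k ∈ u, ‖A n k‖ * w k ≤ M := by
  obtain ⟨j, M, hM⟩ := hA.exists_sum_norm_mul_norm_le (single_mem_maddoxL hp)
    (isGlidingHumpFamily_maddoxL hp)
  refine ⟨(1 / 2) ^ j, M, by positivity, pow_le_one₀ (by norm_num) (by norm_num),
    fun w hw n u hu hδ => ?_⟩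
  calc ∑ k ∈ u, ‖A n k‖ * w k
      = ∑ k ∈ u, ‖A n k‖ * ‖(u : Set ℕ).indicator (fun k => (w k : 𝕜)) k‖ := by
        refine sum_congr rfl fun k hk => ?_
        rw [Set.indicator_of_mem (mem_coe.2 hk), RCLike.norm_of_nonneg (hw k)]
    _ ≤ ∑ k ∈ range (n + 1), ‖A n k‖ * ‖(u : Set ℕ).indicator (fun k => (w k : 𝕜)) k‖ :=
        sum_le_sum_of_subset_of_nonneg hu fun k _ _ => by positivity
    _ ≤ M := hM _ (indicator_mem_modularBall hp hw hδ) n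

theorem sum_rpow_conjExponent_le_one {ι : Type*} {u : Finset ι} {p c : ι → ℝ} {δ : ℝ}
    (hp : ∀ i, 1 < p i) (hc : ∀ i, 0 ≤ c i) (hδ : 0 < δ) (hδ1 : δ ≤ 1)
    (h : ∀ w : ι → ℝ, (∀ i, 0 ≤ w i) → ∑ i ∈ u, w i ^ p i ≤ δ → ∑ i ∈ u, c i * w i < δ) :
    ∑ i ∈ u, c i ^ (p i / (p i - 1)) ≤ 1 := by
  by_contra! hS
  set S := ∑ i ∈ u, c i ^ (p i / (p i - 1)) with hS_def
  have hS0 : 0 < S := one_pos.trans hS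
  have hq (i : ι) : 1 + (p i / (p i - 1) - 1) = p i / (p i - 1) := by ring
  have hqp (i : ι) : (p i / (p i - 1) - 1) * p i = p i / (p i - 1) := by
    have := (sub_pos.2 (hp i)).ne'
    field_simp
    ring
  -- The extremal weight for Hölder's inequality, scaled into the modular ball.
  let w : ι → ℝ := fun i => c i ^ (p i / (p i - 1) - 1) * (δ / S)
  have hmass : ∑ i ∈ u, c i ^ (p i / (p i - 1)) * (δ / S) = δ := by
    rw [← sum_mul, ← hS_def, mul_div_cancel₀ _ hS0.ne']
  have hcw (i : ι) : c i * w i = c i ^ (p i / (p i - 1)) * (δ / S) := by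
    have hq0 : p i / (p i - 1) ≠ 0 := by
      have := hp i
      exact div_ne_zero (by linarith) (by linarith)
    rw [← mul_assoc, ← Real.rpow_one_add' (hc i) (by rwa [hq]), hq]
  have hwp (i : ι) : w i ^ p i ≤ c i ^ (p i / (p i - 1)) * (δ / S) := by
    rw [Real.mul_rpow (Real.rpow_nonneg (hc i) _) (by positivity), ← Real.rpow_mul (hc i), hqp]
    exact mul_le_mul_of_nonneg_left (Real.rpow_le_self_of_le_one (by positivity)
      ((div_le_one hS0).2 (hδ1.trans hS.le)) (hp i).le) (Real.rpow_nonneg (hc i) _)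
  refine (h w (fun i => mul_nonneg (Real.rpow_nonneg (hc i) _) (by positivity))
    ((sum_le_sum fun i _ => hwp i).trans_eq hmass)).ne ?_
  rw [sum_congr rfl fun i _ => hcw i, hmass]

theorem mul_le_mul_rpow_add_rpow {q a b L : ℝ} (hq : 1 < q) (ha : 0 ≤ a) (hb : 0 ≤ b)
    (hL : 0 < L) : a * b ≤ L * ((a / L) ^ (q / (q - 1)) + b ^ q) := by
  have hconj : q.HolderConjugate (q / (q - 1)) := Real.HolderConjugate.conjExponent hq
  calc a * b = L * (a / L * b) := by rw [← mul_assoc, mul_div_cancel₀ _ hL.ne']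
    _ ≤ L * ((a / L) ^ (q / (q - 1)) / (q / (q - 1)) + b ^ q / q) :=
        mul_le_mul_of_nonneg_left
          (Real.young_inequality_of_nonneg (by positivity) hb hconj.symm) hL.le
    _ ≤ L * ((a / L) ^ (q / (q - 1)) + b ^ q) := by
        gcongr
        · exact div_le_self (by positivity) hconj.symm.lt.le
        · exact div_le_self (by positivity) hq.le

theorem mapsToBounded_maddoxL_iff_of_one_lt (hp : ∀ k, 1 < p k) :
    MapsToBounded A (maddoxL p) ↔ ∃ (L : ℕ+) (M : ℝ), ∀ n,
      ∑ k ∈ range (n + 1), (‖A n k‖ / L) ^ (p k / (p k - 1)) ≤ M := by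
  constructor
  · intro hA
    obtain ⟨δ, M, hδ, hδ1, hM⟩ :=
      hA.exists_sum_norm_mul_le_of_sum_rpow_le fun k => one_pos.trans (hp k)
    obtain ⟨m, hm⟩ := exists_nat_gt (M / δ)
    have hL : (0 : ℝ) < m.succPNat := by exact_mod_cast m.succPNat.pos
    have hML : M / m.succPNat < δ := by
      rw [div_lt_comm₀ hL hδ]
      exact hm.trans (by exact_mod_cast m.lt_succ_self)
    refine ⟨m.succPNat, 1, fun n =>
      sum_rpow_conjExponent_le_one hp (fun k => by positivity) hδ hδ1 fun w hw hwδ => ?_⟩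
    calc ∑ k ∈ range (n + 1), ‖A n k‖ / m.succPNat * w k
        = (∑ k ∈ range (n + 1), ‖A n k‖ * w k) / m.succPNat := by
          rw [sum_div]
          exact sum_congr rfl fun k _ => div_mul_eq_mul_div _ _ _
      _ ≤ M / m.succPNat := div_le_div_of_nonneg_right (hM w hw n _ subset_rfl hwδ) hL.le
      _ < δ := hML
  · rintro ⟨L, M, hM⟩
    refine mapsToBounded_of_forall_exists_sum_norm_le fun y hy => ?_
    have hL : (0 : ℝ) < L := by exact_mod_cast L.pos
    refine ⟨L * (M + ∑' k, ‖y k‖ ^ p k), fun n => ?_⟩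
    calc ∑ k ∈ range (n + 1), ‖A n k‖ * ‖y k‖
        ≤ ∑ k ∈ range (n + 1), L * ((‖A n k‖ / L) ^ (p k / (p k - 1)) + ‖y k‖ ^ p k) :=
          sum_le_sum fun k _ =>
            mul_le_mul_rpow_add_rpow (hp k) (norm_nonneg _) (norm_nonneg _) hL
      _ ≤ L * (M + ∑' k, ‖y k‖ ^ p k) := by
          rw [← mul_sum, sum_add_distrib]
          exact mul_le_mul_of_nonneg_left (add_le_add (hM n)
            (Summable.sum_le_tsum _ (fun k _ => by positivity) hy)) hL.le

theorem summable_rpow_of_one_le {f q : ℕ → ℝ} (hf : Summable f) (hf0 : ∀ k, 0 ≤ f k)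
    (hq : ∀ k, 1 ≤ q k) : Summable fun k => f k ^ q k := by
  refine Summable.of_norm_bounded_eventually_nat hf ?_
  filter_upwards [hf.tendsto_atTop_zero.eventually_le_const one_pos] with k hk
  rw [Real.norm_of_nonneg (Real.rpow_nonneg (hf0 k) _)]
  exact Real.rpow_le_self_of_le_one (hf0 k) hk (hq k)

theorem mapsToBounded_maddoxL_iff_of_le_one (hp : ∀ k, 0 < p k) (hp1 : ∀ k, p k ≤ 1) :
    MapsToBounded A (maddoxL p) ↔ ∃ (L : ℕ+) (M : ℝ), ∀ n, ∀ k ≤ n,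
      (‖A n k‖ / L) ^ p k ≤ M := by
  constructor
  · intro hA
    obtain ⟨δ, M, hδ, -, hM⟩ := hA.exists_sum_norm_mul_le_of_sum_rpow_le hp
    obtain ⟨m, hm⟩ := exists_nat_ge M
    have hL : (0 : ℝ) < m.succPNat := by exact_mod_cast m.succPNat.pos
    have hML : M ≤ m.succPNat := hm.trans (by exact_mod_cast m.le_succ)
    refine ⟨m.succPNat, δ⁻¹, fun n k hk => ?_⟩
    have hroot : 0 < δ ^ (p k)⁻¹ := Real.rpow_pos_of_pos hδ _
    have hentry : ‖A n k‖ * δ ^ (p k)⁻¹ ≤ M := by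
      have hk' : {k} ⊆ range (n + 1) := singleton_subset_iff.2 (mem_range_succ_iff.2 hk)
      simpa only [sum_singleton, Real.rpow_inv_rpow hδ.le (hp k).ne', le_refl, forall_const] using
        hM (fun _ => δ ^ (p k)⁻¹) (fun _ => hroot.le) n {k} hk'
    calc (‖A n k‖ / m.succPNat) ^ p k ≤ ((δ ^ (p k)⁻¹)⁻¹) ^ p k := by
          refine Real.rpow_le_rpow (by positivity) ?_ (hp k).le
          rw [div_le_iff₀ hL, ← div_eq_inv_mul, le_div_iff₀ hroot]
          exact hentry.trans hML
      _ = δ⁻¹ := by rw [Real.inv_rpow hroot.le, Real.rpow_inv_rpow hδ.le (hp k).ne']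
  · rintro ⟨L, M, hM⟩
    refine mapsToBounded_of_forall_exists_sum_norm_le fun y hy => ?_
    have hL : (0 : ℝ) < L := by exact_mod_cast L.pos
    have hM0 : 0 ≤ M := le_trans (by positivity) (hM 0 0 le_rfl)
    have hG0 (k : ℕ) : 0 ≤ M * ‖y k‖ ^ p k := by positivity
    have hG : Summable fun k => (M * ‖y k‖ ^ p k) ^ (p k)⁻¹ :=
      summable_rpow_of_one_le (Summable.mul_left M hy) hG0 fun k => (one_le_inv₀ (hp k)).2 (hp1 k)
    refine ⟨L * ∑' k, (M * ‖y k‖ ^ p k) ^ (p k)⁻¹, fun n => ?_⟩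
    have hterm {k : ℕ} (hk : k ≤ n) : ‖A n k‖ / L * ‖y k‖ ≤ (M * ‖y k‖ ^ p k) ^ (p k)⁻¹ := by
      refine le_rpow_inv_of_rpow_le (by positivity) (hp k) ?_
      rw [Real.mul_rpow (by positivity) (norm_nonneg _)]
      exact mul_le_mul_of_nonneg_right (hM n k hk) (by positivity)
    calc ∑ k ∈ range (n + 1), ‖A n k‖ * ‖y k‖
        = L * ∑ k ∈ range (n + 1), ‖A n k‖ / L * ‖y k‖ := by
          rw [mul_sum]
          exact sum_congr rfl fun k _ => by rw [← mul_assoc, mul_div_cancel₀ _ hL.ne']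
      _ ≤ L * ∑' k, (M * ‖y k‖ ^ p k) ^ (p k)⁻¹ :=
          mul_le_mul_of_nonneg_left ((sum_le_sum fun k hk => hterm (mem_range_succ_iff.1 hk)).trans
            (hG.sum_le_tsum _ fun k _ => Real.rpow_nonneg (hG0 k) _)) hL.le

end Maddox

section Gamma

theorem iSup_ofReal_lt_top_iff {ι : Type*} {f : ι → ℝ} :
    (⨆ i, ENNReal.ofReal (f i)) < ⊤ ↔ ∃ M, ∀ i, f i ≤ M := by
  constructor
  · intro h
    exact ⟨_, fun i => (ENNReal.ofReal_le_iff_le_toReal h.ne).1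
      (le_iSup (fun i => ENNReal.ofReal (f i)) i)⟩
  · rintro ⟨M, hM⟩
    exact (iSup_le fun i => ENNReal.ofReal_le_ofReal (hM i)).trans_lt ENNReal.ofReal_lt_top

theorem iSup_iSup_ofReal_lt_top_iff {f : ℕ → ℕ → ℝ} (hf : ∀ n k, 0 ≤ f n k)
    (hf_upper : ∀ n k, n < k → f n k = 0) :
    (⨆ n, ⨆ k, ENNReal.ofReal (f n k)) < ⊤ ↔ ∃ M, ∀ n, ∀ k ≤ n, f n k ≤ M := by
  rw [← iSup_prod (f := fun x : ℕ × ℕ => ENNReal.ofReal (f x.1 x.2)), iSup_ofReal_lt_top_iff]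
  refine exists_congr fun M => ⟨fun h n k _ => h (n, k), fun h (n, k) => ?_⟩
  rcases le_or_gt k n with hk | hk
  · exact h n k hk
  · rw [hf_upper n k hk]
    exact (hf 0 0).trans (h 0 0 le_rfl)

theorem iSup_tsum_ofReal_lt_top_iff {f : ℕ → ℕ → ℝ} (hf : ∀ n k, 0 ≤ f n k)
    (hf_upper : ∀ n k, n < k → f n k = 0) :
    (⨆ n, ∑' k, ENNReal.ofReal (f n k)) < ⊤ ↔ ∃ M, ∀ n, ∑ k ∈ range (n + 1), f n k ≤ M := by
  have hrow (n : ℕ) :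
      ∑' k, ENNReal.ofReal (f n k) = ENNReal.ofReal (∑ k ∈ range (n + 1), f n k) := by
    rw [ENNReal.ofReal_sum_of_nonneg fun k _ => hf n k]
    refine tsum_eq_sum fun k hk => ?_
    rw [hf_upper n k (by simpa using hk), ENNReal.ofReal_zero]
  simp only [hrow, iSup_ofReal_lt_top_iff]

variable {r s t a : ℕ → 𝕜} {p : ℕ → ℝ}

theorem norm_mul_inv_natCast (z : 𝕜) (L : ℕ) : ‖z * (L : 𝕜)⁻¹‖ = ‖z‖ / L := by
  rw [← div_eq_mul_inv, norm_div, RCLike.norm_natCast]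

theorem mem_Gamma1_iff (hp : ∀ k, 0 < p k) :
    a ∈ Gamma1 r s t p ↔ MapsToBounded (E r s t a) (maddoxC0 p) := by
  rw [mapsToBounded_maddoxC0_iff hp, Gamma1, Set.mem_iUnion]
  refine exists_congr fun L =>
    iSup_tsum_ofReal_lt_top_iff (fun n k => by positivity) fun n k h => ?_
  rw [E_eq_zero r s t a h, norm_zero, zero_mul]

theorem mem_Gamma2_iff :
    a ∈ Gamma2 r s t ↔ BddAbove (Set.range fun n => ‖∑ k ∈ range (n + 1), E r s t a n k‖) := by
  have hrow (n : ℕ) : ∑' k, E r s t a n k = ∑ k ∈ range (n + 1), E r s t a n k :=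
    tsum_eq_sum fun k hk => E_eq_zero r s t a (by simpa using hk)
  simp only [Gamma2, Set.mem_ofPred_eq, hrow]

theorem mem_Gamma3_iff (hp : ∀ k, 0 < p k) :
    a ∈ Gamma3 r s t p ↔ MapsToBounded (E r s t a) (maddoxLinf p) := by
  rw [mapsToBounded_maddoxLinf_iff hp, Gamma3, Set.mem_iInter]
  refine forall_congr' fun L =>
    iSup_tsum_ofReal_lt_top_iff (fun n k => by positivity) fun n k h => ?_
  rw [E_eq_zero r s t a h, norm_zero, zero_mul]

theorem mem_Gamma4_iff (hp : ∀ k, 0 < p k) (hp1 : ∀ k, p k ≤ 1) :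
    a ∈ Gamma4 r s t p ↔ MapsToBounded (E r s t a) (maddoxL p) := by
  rw [mapsToBounded_maddoxL_iff_of_le_one hp hp1, Gamma4, Set.mem_iUnion]
  simp only [norm_mul_inv_natCast]
  refine exists_congr fun L =>
    iSup_iSup_ofReal_lt_top_iff (fun n k => by positivity) fun n k h => ?_
  rw [E_eq_zero r s t a h, norm_zero, zero_div, Real.zero_rpow (hp k).ne']

theorem mem_Gamma5_iff (hp : ∀ k, 1 < p k) :
    a ∈ Gamma5 r s t p ↔ MapsToBounded (E r s t a) (maddoxL p) := by
  rw [mapsToBounded_maddoxL_iff_of_one_lt hp, Gamma5, Set.mem_iUnion]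
  simp only [norm_mul_inv_natCast]
  refine exists_congr fun L =>
    iSup_tsum_ofReal_lt_top_iff (fun n k => by positivity) fun n k h => ?_
  have hq : p k / (p k - 1) ≠ 0 := (Real.HolderConjugate.conjExponent (hp k)).symm.ne_zero
  rw [E_eq_zero r s t a h, norm_zero, zero_div, Real.zero_rpow hq]

end Gamma

end GenMeans

theorem theorem4p4_general {𝕜 : Type*} [RCLike 𝕜] (r s t : ℕ → 𝕜) (p : ℕ → ℝ)
    (hr : ∀ n, r n ≠ 0) (ht : ∀ n, t n ≠ 0) (hs : s 0 ≠ 0) (hp : ∀ k, 0 < p k) :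
    ((∀ k, 1 < p k) →
      GenMeans.gammaDual (GenMeans.meanDiffSpace (GenMeans.maddoxL p) r s t) =
        GenMeans.Gamma5 r s t p) ∧
    ((∀ k, p k ≤ 1) →
      GenMeans.gammaDual (GenMeans.meanDiffSpace (GenMeans.maddoxL p) r s t) =
        GenMeans.Gamma4 r s t p) ∧
    GenMeans.gammaDual (GenMeans.meanDiffSpace (GenMeans.maddoxC0 p) r s t) =
      GenMeans.Gamma1 r s t p ∧
    GenMeans.gammaDual (GenMeans.meanDiffSpace (GenMeans.maddoxC p) r s t) =
      GenMeans.Gamma1 r s t p ∩ GenMeans.Gamma2 r s t ∧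
    GenMeans.gammaDual (GenMeans.meanDiffSpace (GenMeans.maddoxLinf p) r s t) =
      GenMeans.Gamma3 r s t p := by
  have hdual (X : Set (ℕ → 𝕜)) (a : ℕ → 𝕜) :
      a ∈ GenMeans.gammaDual (GenMeans.meanDiffSpace X r s t) ↔
        GenMeans.MapsToBounded (GenMeans.E r s t a) X :=
    GenMeans.mem_gammaDual_meanDiffSpace_iff hr ht hs
  refine ⟨fun hp1 => Set.ext fun a => ?_, fun hp1 => Set.ext fun a => ?_, Set.ext fun a => ?_,
    Set.ext fun a => ?_, Set.ext fun a => ?_⟩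
  · rw [hdual, GenMeans.mem_Gamma5_iff hp1]
  · rw [hdual, GenMeans.mem_Gamma4_iff hp hp1]
  · rw [hdual, GenMeans.mem_Gamma1_iff hp]
  · rw [hdual, GenMeans.mapsToBounded_maddoxC_iff hp, Set.mem_inter_iff,
      GenMeans.mem_Gamma1_iff hp, GenMeans.mem_Gamma2_iff]
  · rw [hdual, GenMeans.mem_Gamma3_iff hp]

theorem theorem4p4 {𝕜 : Type*} [RCLike 𝕜] (r s t : ℕ → 𝕜) (p : ℕ → ℝ)
    (hr : ∀ n, r n ≠ 0) (ht : ∀ n, t n ≠ 0) (hs : s 0 ≠ 0)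
    (hp : ∀ k, 0 < p k) (hpb : BddAbove (Set.range p)) :
    ((∀ k, 1 < p k) →
      GenMeans.gammaDual (GenMeans.meanDiffSpace (GenMeans.maddoxL p) r s t) =
        GenMeans.Gamma5 r s t p) ∧
    ((∀ k, p k ≤ 1) →
      GenMeans.gammaDual (GenMeans.meanDiffSpace (GenMeans.maddoxL p) r s t) =
        GenMeans.Gamma4 r s t p) ∧
    GenMeans.gammaDual (GenMeans.meanDiffSpace (GenMeans.maddoxC0 p) r s t) =
      GenMeans.Gamma1 r s t p ∧
    GenMeans.gammaDual (GenMeans.meanDiffSpace (GenMeans.maddoxC p) r s t) =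
      GenMeans.Gamma1 r s t p ∩ GenMeans.Gamma2 r s t ∧
    GenMeans.gammaDual (GenMeans.meanDiffSpace (GenMeans.maddoxLinf p) r s t) =
      GenMeans.Gamma3 r s t p :=
  theorem4p4_general r s t p hr ht hs hp
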